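/- Let $T:\mathbf{Set}\to\mathbf{Set}$ be a functor, let $\mathcal Q$ be the contravariant powerset functor, let $\mathsf V$ be an infinite set of fixed point variables, and let $\mathcal L$ be a set of modalities, each $L\in\mathcal L$ with a finite arity $\mathrm{ar}(L)\in\omega$ and an $\mathrm{ar}(L)$-ary predicate lifting $[\![L]\!]:\mathcal Q^{\mathrm{ar}(L)}\to\mathcal Q T^{\mathrm{op}}$ (a natural transformation). Assume that each $[\![L]\!]$ is monotone (it preserves inclusion in every argument) and preserves singletons ($[\![L]\!]_X(\{x_1\},\dots,\{x_n\})$ has exactly one element for all sets $X$ and $x_1,\dots,x_n\in X$, $n=\mathrm{ar}(L)$), and that $\{[\![L]\!]\mid L\in\mathcal L\}$ is strongly expressive: for every set $X$ and every $t\in TX$ there are $L\in\mathcal L$ and $x_1,\dots,x_n\in X$, $n=\mathrm{ar}(L)$, with $\{t\}=[\![L]\!]_X(\{x_1\},\dots,\{x_n\})$. Expressions are given by the grammar $\phi::=z\mid\nu z.\,\phi\mid L(\phi_1,\dots,\phi_n)$ with $z\in\mathsf V$, $L\in\mathcal L$, $n=\mathrm{ar}(L)$. An expression is closed if it has no free variables,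 and guarded if every bound occurrence of a variable is separated by at least one modality from the fixed point operator binding it; $\mathcal E_0$ is the set of closed and guarded expressions. In a $T$-coalgebra $C=(X,\xi:X\to TX)$ with a valuation $\kappa:\mathsf V\to\mathcal Q X$, expressions are interpreted as subsets of $X$ by $[\![z]\!]_C^\kappa=\kappa(z)$, $[\![L(\phi_1,\dots,\phi_n)]\!]_C^\kappa=\xi^{-1}\big[[\![L]\!]_X([\![\phi_1]\!]_C^\kappa,\dots,[\![\phi_n]\!]_C^\kappa)\big]$, and $[\![\nu z.\,\phi]\!]_C^\kappa$ is the greatest fixed point of the monotone map $Y\mapsto[\![\phi]\!]_C^{\kappa[z\mapsto Y]}$; for closed $\phi$ this does not depend on $\kappa$, and one writes $[\![\phi]\!]_C$. States $x$ of $C$ and $y$ of $D$ are behaviourally equivalent if there are a $T$-coalgebra $E$ and coalgebra morphisms $f:C\to E$, $g:D\to E$ with $f(x)=g(y)$. A closed expression $\phi$ denotes the behavioural equivalence class of a state $x$ if for every $T$-coalgebra $D$, $[\![\phi]\!]_D$ is exactly the set of states of $D$ that are behaviourally equivalent to $x$. Then every expression $\phi\in\mathcal E_0$ denotes the behavioural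 equivalence class of some state in a finite $T$-coalgebra; and conversely, for every state $x$ in a finite $T$-coalgebra there is an expression $\phi\in\mathcal E_0$ that denotes the behavioural equivalence class of $x$. -/

import Mathlib

open CategoryTheory

universe u v w

namespace GenExpr

/-- An `n`-ary predicate lifting for a set functor `T`: a natural transformation
`Qⁿ → Q Tᵒᵖ`, where `Q` is the contravariant powerset functor (acting by preimage). -/
structure PredicateLifting (T : Type u ⥤ Type u) (n : ℕ) where
  /-- The components of the transformation. -/
  app : ∀ X : Type u, (Fin n → Set X) → Set (T.obj X)
  naturality : ∀ {X Y : Type u} (f : X ⟶ Y) (A : Fin n → Set Y),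
    app X (fun i => f ⁻¹' A i) = T.map f ⁻¹' app Y A

/-- Monotonicity: inclusion is preserved in every argument. -/
def PredicateLifting.IsMonotone {T : Type u ⥤ Type u} {n : ℕ} (l : PredicateLifting T n) :
    Prop :=
  ∀ X : Type u, Monotone (l.app X)

/-- Preservation of singletons: `λ_X({x₁}, …, {xₙ})` has exactly one element. -/
def PredicateLifting.PreservesSingletons {T : Type u ⥤ Type u} {n : ℕ}
    (l : PredicateLifting T n) : Prop :=
  ∀ (X : Type u) (x : Fin n → X), ∃ t : T.obj X, l.app X (fun i => {x i}) = {t}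

/-- A set of predicate liftings (of arbitrary finite arities) is strongly expressive if every
`{t}`, `t ∈ T X`, is of the form `λ_X({x₁}, …, {xₙ})` for some `λ` in the set. -/
def StronglyExpressive {T : Type u ⥤ Type u} (S : Set (Σ n : ℕ, PredicateLifting T n)) :
    Prop :=
  ∀ (X : Type u) (t : T.obj X), ∃ l ∈ S, ∃ x : Fin l.1 → X,
    ({t} : Set (T.obj X)) = l.2.app X (fun i => {x i})

/-- Expressions `φ ::= z | νz. φ | L(φ₁, …, φₙ)` over fixed point variables `V` and
modalities `M` with arity function `ar`. -/
inductive Expr (V : Type v) (M : Type w) (ar : M → ℕ) : Type (max v w)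
  | var (z : V) : Expr V M ar
  | nu (z : V) (φ : Expr V M ar) : Expr V M ar
  | mod (L : M) (φ : Fin (ar L) → Expr V M ar) : Expr V M ar

namespace Expr

variable {V : Type v} {M : Type w} {ar : M → ℕ}

/-- The variables with a free occurrence. -/
def freeVars : Expr V M ar → Set V
  | var z => {z}
  | nu z φ => freeVars φ \ {z}
  | mod _ φ => ⋃ i, freeVars (φ i)

/-- The variables with a free occurrence that is not in the scope of any modality. -/
def unguardedVars : Expr V M ar → Set V
  | var z => {z}
  | nu z φ => unguardedVars φ \ {z}
  | mod _ _ => ∅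

/-- Every bound variable is bound by some enclosing fixed point operator. -/
def Closed (φ : Expr V M ar) : Prop := freeVars φ = ∅

/-- Every bound occurrence of a variable is separated from the fixed point operator binding it
by at least one modality. -/
def Guarded : Expr V M ar → Prop
  | var _ => True
  | nu z φ => z ∉ unguardedVars φ ∧ Guarded φ
  | mod _ φ => ∀ i, Guarded (φ i)

open Classical in
/-- The semantics of an expression in a coalgebra `C`, as a monotone map taking a valuation
`κ : V → Q C` to a subset of `C`. Fixed point operators are interpreted as greatest fixed points
in the powerset lattice; the predicate liftings interpreting modalities have to be monotone for
these to be greatest fixed points of monotone maps. -/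
noncomputable def sem {T : Type u ⥤ Type u} (lift : ∀ L : M, PredicateLifting T (ar L))
    (hmono : ∀ L, (lift L).IsMonotone) (C : Endofunctor.Coalgebra T) :
    Expr V M ar → ((V → Set C.V) →o Set C.V)
  | var z => ⟨fun κ => κ z, fun _ _ h => h z⟩
  | nu z φ =>
    { toFun := fun κ => OrderHom.gfp
        ⟨fun Y => sem lift hmono C φ (Function.update κ z Y), fun _ _ h =>
          (sem lift hmono C φ).monotone (update_le_update_iff.2 ⟨h, fun _ _ => le_rfl⟩)⟩
      monotone' := fun _ _ h => OrderHom.gfp.monotone fun _ =>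
        (sem lift hmono C φ).monotone
          (update_le_update_iff.2 ⟨le_rfl, fun j _ => h j⟩) }
  | mod L φ =>
    { toFun := fun κ => C.str ⁻¹' (lift L).app C.V (fun i => sem lift hmono C (φ i) κ)
      monotone' := fun _ _ h => Set.preimage_mono <|
        hmono L C.V fun i => (sem lift hmono C (φ i)).monotone h }

end Expr

/-- States `x` in `C` and `y` in `D` are behaviourally equivalent if they are identified by
coalgebra morphisms into some common coalgebra. -/
def BehaviourallyEquivalent {T : Type u ⥤ Type u} (C D : Endofunctor.Coalgebra T)
    (x : C.V) (y : D.V) : Prop :=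
  ∃ (E : Endofunctor.Coalgebra T) (f : C ⟶ E) (g : D ⟶ E), f.f x = g.f y

/-- `φ` denotes the behavioural equivalence class of the state `x` of `C`: in every coalgebra `D`
(and under every valuation, which is irrelevant for closed `φ`), the semantics of `φ` consists of
precisely the states of `D` that are behaviourally equivalent to `x`. -/
def Denotes {V : Type v} {M : Type w} {ar : M → ℕ} {T : Type u ⥤ Type u}
    (lift : ∀ L : M, PredicateLifting T (ar L)) (hmono : ∀ L, (lift L).IsMonotone)
    (φ : Expr V M ar) (C : Endofunctor.Coalgebra T) (x : C.V) : Prop :=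
  ∀ (D : Endofunctor.Coalgebra T) (κ : V → Set D.V),
    φ.sem lift hmono D κ = {y | BehaviourallyEquivalent C D x y}

end GenExpr

namespace GenExpr

/-! Expressions and coalgebras meet in finite flat systems of equations `x = L(p₁, …, pₙ)`, solved
greatest in every coalgebra. Bekić's principle (`gfp_eq_sol_close`) turns a guarded expression into
such a system and, conversely, expresses any component of a finite variable-free system by nested
`ν`s.

A variable-free system corresponds to a coalgebra: preservation of singletons selects a successor in
`L({x₁}, …, {xₙ})`, and strong expressivity reads such an equation off each state. The greatest
solution then consists of behavioural equivalence classes. These form a post-fixed point by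
naturality and monotonicity; conversely, gluing both coalgebras along the solution yields a
coalgebra, since liftings of singletons have one element. -/

/-- A system of equations over modalities: every state carries a modality, the arguments of which
are states or variables. -/
structure EqSystem (V : Type v) (M : Type w) (ar : M → ℕ) where
  /-- The unknowns of the system. -/
  carrier : Type u
  /-- The modality at the head of the right-hand side. -/
  op : carrier → M
  /-- The arguments of the right-hand side. -/
  arg : ∀ x, Fin (ar (op x)) → carrier ⊕ V

/-- Sum elimination is monotone in both families. -/
theorem sumElim_mono {X : Type*} {V : Type*} {α : Type*} [Preorder α] {S S' : X → α}
    {κ κ' : V → α} (hS : S ≤ S') (hκ : κ ≤ κ') (p : X ⊕ V) :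
    Sum.elim S κ p ≤ Sum.elim S' κ' p := by
  cases p with
  | inl x => exact hS x
  | inr z => exact hκ z

/-! ### Greatest solutions, closing and joining of systems -/

namespace EqSystem

variable {V : Type v} {M : Type w} {ar : M → ℕ} {T : Type u ⥤ Type u}
  (lift : ∀ L : M, PredicateLifting T (ar L)) (hmono : ∀ L, (lift L).IsMonotone)

/-- The operator given by the right-hand sides of a system, in a coalgebra with a valuation. -/
def step (A : EqSystem.{u} V M ar) (D : Endofunctor.Coalgebra T) (κ : V → Set D.V) :
    (A.carrier → Set D.V) →o (A.carrier → Set D.V) where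
  toFun S x := D.str ⁻¹' (lift (A.op x)).app D.V (fun i => Sum.elim S κ (A.arg x i))
  monotone' _ _ h x := Set.preimage_mono <|
    hmono (A.op x) D.V fun i => sumElim_mono h le_rfl (A.arg x i)

/-- The greatest solution of a system. -/
def sol (A : EqSystem.{u} V M ar) (D : Endofunctor.Coalgebra T) (κ : V → Set D.V) :
    A.carrier → Set D.V :=
  (A.step lift hmono D κ).gfp

theorem sol_eq (A : EqSystem.{u} V M ar) (D : Endofunctor.Coalgebra T) (κ : V → Set D.V)
    (x : A.carrier) :
    A.sol lift hmono D κ x = D.str ⁻¹' (lift (A.op x)).app D.V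
      (fun i => Sum.elim (A.sol lift hmono D κ) κ (A.arg x i)) :=
  (congrFun (A.step lift hmono D κ).map_gfp x).symm

theorem le_sol (A : EqSystem.{u} V M ar) (D : Endofunctor.Coalgebra T) (κ : V → Set D.V)
    (S : A.carrier → Set D.V)
    (h : ∀ x, S x ⊆ D.str ⁻¹' (lift (A.op x)).app D.V (fun i => Sum.elim S κ (A.arg x i))) :
    S ≤ A.sol lift hmono D κ :=
  OrderHom.le_gfp _ h

open Classical in
/-- Replace the variable `z` by the state `s` in an argument. -/
noncomputable def redirect {X : Type*} {V : Type*} (z : V) (s : X) : X ⊕ V → X ⊕ V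
  | .inl x => .inl x
  | .inr y => if y = z then .inl s else .inr y

/-- Replace the variable `z` by the state `s` everywhere in a system. -/
noncomputable def close (A : EqSystem.{u} V M ar) (z : V) (s : A.carrier) :
    EqSystem.{u} V M ar where
  carrier := A.carrier
  op := A.op
  arg x i := redirect z s (A.arg x i)

open Classical in
theorem elim_redirect {X : Type*} {V : Type*} {α : Type*} (z : V) (s : X) (S : X → α)
    (κ : V → α) (p : X ⊕ V) :
    Sum.elim S κ (redirect z s p) = Sum.elim S (Function.update κ z (S s)) p := by
  cases p with
  | inl x => rfl
  | inr y =>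
    by_cases h : y = z
    · subst h; simp [redirect]
    · simp [redirect, h]

open Classical in
/-- A solution of the closed system is a solution of the system in which the variable is
interpreted by the component of the state that replaces it. -/
theorem sol_close_le (A : EqSystem.{u} V M ar) (z : V) (s : A.carrier)
    (D : Endofunctor.Coalgebra T) (κ : V → Set D.V) :
    (A.close z s).sol lift hmono D κ ≤
      A.sol lift hmono D (Function.update κ z ((A.close z s).sol lift hmono D κ s)) := by
  refine A.le_sol lift hmono D _ _ fun x => ?_
  have h := ((A.close z s).sol_eq lift hmono D κ x).le
  refine h.trans (le_of_eq ?_)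
  simp only [close, elim_redirect]

open Classical in
-- Once `Y` lies in the component at `s`, reading `z` as that component only enlarges the right-hand
-- sides, so the old solution is post-fixed for the closed system.
theorem le_sol_close (A : EqSystem.{u} V M ar) (z : V) (s : A.carrier)
    (D : Endofunctor.Coalgebra T) (κ : V → Set D.V) (Y : Set D.V)
    (hY : Y ⊆ A.sol lift hmono D (Function.update κ z Y) s) :
    A.sol lift hmono D (Function.update κ z Y) ≤ (A.close z s).sol lift hmono D κ := by
  refine (A.close z s).le_sol lift hmono D κ _ fun x => ?_
  refine (A.sol_eq lift hmono D _ x).le.trans ?_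
  refine Set.preimage_mono (hmono _ _ fun i => ?_)
  simp only [close, elim_redirect]
  exact sumElim_mono le_rfl (update_le_update_iff.2 ⟨hY, fun _ _ => le_rfl⟩) _

open Classical in
/-- Bekić's principle: a nested greatest fixed point is a component of a greatest solution. -/
theorem gfp_eq_sol_close (A : EqSystem.{u} V M ar) (z : V) (s : A.carrier)
    (D : Endofunctor.Coalgebra T) (κ : V → Set D.V) (F : Set D.V →o Set D.V)
    (hF : ∀ Y, F Y = A.sol lift hmono D (Function.update κ z Y) s) :
    F.gfp = (A.close z s).sol lift hmono D κ s := by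
  apply le_antisymm
  · have h : F.gfp ⊆ A.sol lift hmono D (Function.update κ z F.gfp) s := by
      rw [← hF, F.map_gfp]
    exact h.trans (A.le_sol_close lift hmono z s D κ _ h s)
  · refine F.le_gfp ?_
    rw [hF]
    exact A.sol_close_le lift hmono z s D κ s

/-- The system with no states. -/
def empty : EqSystem.{u} V M ar where
  carrier := PEmpty
  op x := x.elim
  arg x := x.elim

/-- The disjoint union of systems for the arguments of a modality, with a new state for the
modality itself. -/
def join (L : M) (A : Fin (ar L) → EqSystem.{u} V M ar)
    (p : ∀ i, (A i).carrier ⊕ V) : EqSystem.{u} V M ar where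
  carrier := Option (Σ i, (A i).carrier)
  op
    | none => L
    | some ⟨i, x⟩ => (A i).op x
  arg
    | none => fun i => (p i).map (fun x => some ⟨i, x⟩) id
    | some ⟨i, x⟩ => fun j => ((A i).arg x j).map (fun x => some ⟨i, x⟩) id

/-- Equations in one block mention neither other blocks nor the new state, so blocks are solved
independently. -/
theorem sol_join_some (L : M) (A : Fin (ar L) → EqSystem.{u} V M ar)
    (p : ∀ i, (A i).carrier ⊕ V) (D : Endofunctor.Coalgebra T) (κ : V → Set D.V)
    (i : Fin (ar L)) :
    (fun x => (join L A p).sol lift hmono D κ (some ⟨i, x⟩)) = (A i).sol lift hmono D κ := by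
  apply le_antisymm
  · refine (A i).le_sol lift hmono D κ _ fun x => ?_
    refine ((join L A p).sol_eq lift hmono D κ (some ⟨i, x⟩)).le.trans (le_of_eq ?_)
    simp only [join, Sum.elim_map]
    rfl
  · let S : (join L A p).carrier → Set D.V
      -- The equations of the blocks never mention `none`, and with `∅` its own inequality is
      -- trivial.
      | none => ∅
      | some ⟨i, x⟩ => (A i).sol lift hmono D κ x
    have hS : S ≤ (join L A p).sol lift hmono D κ := by
      refine (join L A p).le_sol lift hmono D κ S fun x => ?_
      match x with
      | none => exact Set.empty_subset _
      | some ⟨i, x⟩ =>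
        refine ((A i).sol_eq lift hmono D κ x).le.trans (Set.preimage_mono ?_)
        refine hmono _ _ fun j => ?_
        exact le_of_eq (Sum.elim_map (f₂ := S) (g₂ := κ) (x := (A i).arg x j)
          (f₁ := fun y => (some ⟨i, y⟩ : Option (Σ i, (A i).carrier))) (g₁ := id)).symm
    exact fun x => hS (some ⟨i, x⟩)

theorem sol_join_none (L : M) (A : Fin (ar L) → EqSystem.{u} V M ar)
    (p : ∀ i, (A i).carrier ⊕ V) (D : Endofunctor.Coalgebra T) (κ : V → Set D.V) :
    (join L A p).sol lift hmono D κ none = D.str ⁻¹' (lift L).app D.V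
      (fun i => Sum.elim ((A i).sol lift hmono D κ) κ (p i)) := by
  refine ((join L A p).sol_eq lift hmono D κ none).trans ?_
  simp only [← sol_join_some lift hmono L A p D κ, join, Sum.elim_map]
  rfl

end EqSystem

section

variable {V : Type v} {M : Type w} {ar : M → ℕ} {T : Type u ⥤ Type u}
  (lift : ∀ L : M, PredicateLifting T (ar L)) (hmono : ∀ L, (lift L).IsMonotone)

/-! ### From guarded expressions to finite systems -/

theorem Expr.unguardedVars_subset_freeVars (φ : Expr V M ar) :
    φ.unguardedVars ⊆ φ.freeVars := by
  induction φ with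
  | var z => exact subset_rfl
  | nu z φ ih => exact Set.sdiff_subset_sdiff_left ih
  | mod L φ ih => exact Set.empty_subset _

open Classical in
/-- Every guarded expression is a component of the greatest solution of a finite system. -/
theorem Expr.exists_eqSystem (φ : Expr V M ar) (hφ : φ.Guarded) :
    ∃ (A : EqSystem.{u} V M ar) (p : A.carrier ⊕ V), Finite A.carrier ∧
      (∀ x i z, A.arg x i = .inr z → z ∈ φ.freeVars) ∧
      (∀ z, p = .inr z → z ∈ φ.unguardedVars) ∧
      ∀ (D : Endofunctor.Coalgebra T) (κ : V → Set D.V),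
        φ.sem lift hmono D κ = Sum.elim (A.sol lift hmono D κ) κ p := by
  induction φ with
  | var z =>
    refine ⟨EqSystem.empty, .inr z, inferInstanceAs (Finite PEmpty), fun x => x.elim, ?_,
      fun _ _ => rfl⟩
    rintro y ⟨⟩
    exact rfl
  | nu z φ ih =>
    obtain ⟨A, p, hfin, harg, hp, hsem⟩ := ih hφ.2
    cases p with
    -- The body means just the variable `y`, and guardedness excludes `y = z`: the operator is
    -- constant.
    | inr y =>
      have hyz : y ≠ z := fun h => hφ.1 (h ▸ hp y rfl)
      refine ⟨EqSystem.empty, .inr y, inferInstanceAs (Finite PEmpty), fun x => x.elim, ?_, ?_⟩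
      · rintro _ ⟨⟩
        exact ⟨hp y rfl, hyz⟩
      · intro D κ
        have hc : ∀ Y, φ.sem lift hmono D (Function.update κ z Y) = κ y := fun Y => by
          rw [hsem]
          exact Function.update_of_ne hyz _ _
        apply le_antisymm
        · exact OrderHom.gfp_le _ fun Y hY => hY.trans (hc Y).le
        · exact OrderHom.le_gfp _ (hc (κ y)).ge
    | inl s =>
      refine ⟨A.close z s, .inl s, hfin, ?_, nofun, ?_⟩
      · intro x i y h
        change EqSystem.redirect z s (A.arg x i) = .inr y at h
        cases hq : A.arg x i with
        | inl x' => simp [hq, EqSystem.redirect] at h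
        | inr y' =>
          by_cases hy : y' = z
          · simp [hq, EqSystem.redirect, hy] at h
          · simp only [hq, EqSystem.redirect, hy, if_false, Sum.inr.injEq] at h
            subst h
            exact ⟨harg x i _ hq, hy⟩
      · intro D κ
        exact EqSystem.gfp_eq_sol_close lift hmono A z s D κ _ fun Y => hsem D _
  | mod L φ ih =>
    choose A p hfin harg hp hsem using fun i => ih i (hφ i)
    refine ⟨EqSystem.join L A p, .inl none,
      inferInstanceAs (Finite (Option (Σ i, (A i).carrier))), ?_, nofun, ?_⟩
    · intro x i z h
      match x with
      | none =>
        change (p i).map _ _ = _ at h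
        cases hq : p i with
        | inl x' => simp [hq] at h
        | inr y =>
          rw [hq] at h
          obtain rfl : y = z := Sum.inr.inj h
          exact Set.mem_iUnion.2 ⟨i, unguardedVars_subset_freeVars _ (hp i y hq)⟩
      | some ⟨j, x⟩ =>
        change ((A j).arg x i).map _ _ = _ at h
        cases hq : (A j).arg x i with
        | inl x' => simp [hq] at h
        | inr y =>
          rw [hq] at h
          obtain rfl : y = z := Sum.inr.inj h
          exact Set.mem_iUnion.2 ⟨j, harg j x i y hq⟩
    · intro D κ
      refine Eq.trans ?_ (EqSystem.sol_join_none lift hmono L A p D κ).symm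
      simp only [← hsem]
      rfl

/-! ### Greatest solutions and behavioural equivalence -/

/-- Naturality of a monotone predicate lifting along singletons. -/
theorem PredicateLifting.map_mem_app_singleton {n : ℕ} {l : PredicateLifting T n}
    (hl : l.IsMonotone) {X Y : Type u} (f : X ⟶ Y) {A : Fin n → Set X} {y : Fin n → Y}
    (hA : ∀ i, ∀ x ∈ A i, f x = y i) {t : T.obj X} (ht : t ∈ l.app X A) :
    T.map f t ∈ l.app Y (fun i => {y i}) := by
  have h : A ≤ fun i => f ⁻¹' {y i} := fun i x hx => hA i x hx
  have h' := hl X h ht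
  rw [l.naturality f] at h'
  exact h'

/-- The behavioural equivalence classes of the states of a coalgebra satisfy the system of
equations read off its structure. -/
theorem behaviourallyEquivalent_le_sol (A : EqSystem.{u} V M ar)
    (a : ∀ x, Fin (ar (A.op x)) → A.carrier) (ha : ∀ x i, A.arg x i = .inl (a x i))
    (str : A.carrier ⟶ T.obj A.carrier)
    (hstr : ∀ x, str x ∈ (lift (A.op x)).app A.carrier (fun i => {a x i}))
    (D : Endofunctor.Coalgebra T) (κ : V → Set D.V) (x : A.carrier) :
    {y | BehaviourallyEquivalent ⟨A.carrier, str⟩ D x y} ⊆ A.sol lift hmono D κ x := by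
  refine A.le_sol lift hmono D κ
    (fun x => {y | BehaviourallyEquivalent ⟨A.carrier, str⟩ D x y}) (fun x => ?_) x
  rintro y ⟨E, f, g, hfg⟩
  have h₁ : T.map f.f (str x) ∈ (lift (A.op x)).app E.V (fun i => {f.f (a x i)}) :=
    PredicateLifting.map_mem_app_singleton (hmono _) f.f (by rintro i _ rfl; rfl) (hstr x)
  have h₂ : T.map f.f (str x) = T.map g.f (D.str y) := by
    have hf := ConcreteCategory.congr_hom f.h x
    have hg := ConcreteCategory.congr_hom g.h y
    exact hf.trans ((congrArg E.str hfg).trans hg.symm)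
  rw [h₂] at h₁
  have h₃ : D.str y ∈ (lift (A.op x)).app D.V (fun i => g.f ⁻¹' {f.f (a x i)}) := by
    rw [(lift (A.op x)).naturality g.f]
    exact h₁
  refine hmono _ _ (fun i => ?_) h₃
  rw [ha]
  -- The same cospan witnesses equivalence for all the arguments.
  exact fun y' hy' => ⟨E, f, g, Eq.symm hy'⟩

/-- The states in the components of a solution are behaviourally equivalent to the states of the
coalgebra that the system was read off. -/
theorem sol_le_behaviourallyEquivalent (hsing : ∀ L, (lift L).PreservesSingletons)
    (A : EqSystem.{u} V M ar)
    (a : ∀ x, Fin (ar (A.op x)) → A.carrier) (ha : ∀ x i, A.arg x i = .inl (a x i))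
    (str : A.carrier ⟶ T.obj A.carrier)
    (hstr : ∀ x, str x ∈ (lift (A.op x)).app A.carrier (fun i => {a x i}))
    (D : Endofunctor.Coalgebra T) (κ : V → Set D.V) (x : A.carrier) :
    A.sol lift hmono D κ x ⊆ {y | BehaviourallyEquivalent ⟨A.carrier, str⟩ D x y} := by
  intro y hy
  let r : A.carrier ⊕ D.V → A.carrier ⊕ D.V → Prop := fun p q =>
    ∃ x y, p = .inl x ∧ q = .inr y ∧ y ∈ A.sol lift hmono D κ x
  let ql : A.carrier ⟶ Quot r := TypeCat.ofHom fun x => Quot.mk r (.inl x)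
  let qr : D.V ⟶ Quot r := TypeCat.ofHom fun y => Quot.mk r (.inr y)
  have hq : ∀ x, ∀ y ∈ A.sol lift hmono D κ x, qr y = ql x := fun x y h =>
    (Quot.sound ⟨x, y, rfl, rfl, h⟩).symm
  let e : Quot r → T.obj (Quot r) := Quot.lift
    (Sum.elim (fun x => T.map ql (str x)) (fun y => T.map qr (D.str y))) <| by
      rintro _ _ ⟨x, y, rfl, rfl, h⟩
      -- Both candidate successors lie in the lifting of the same singletons, which has a single
      -- element; hence `e` respects `r`.
      obtain ⟨t, ht⟩ := hsing (A.op x) (Quot r) (fun i => ql (a x i))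
      have h₁ : T.map ql (str x) ∈ (lift (A.op x)).app (Quot r) (fun i => {ql (a x i)}) :=
        PredicateLifting.map_mem_app_singleton (hmono _) ql (by rintro i _ rfl; rfl) (hstr x)
      have h₂ : T.map qr (D.str y) ∈ (lift (A.op x)).app (Quot r) (fun i => {ql (a x i)}) := by
        rw [A.sol_eq] at h
        refine PredicateLifting.map_mem_app_singleton (hmono _) qr (fun i y' hy' => ?_) h
        rw [ha] at hy'
        exact hq _ _ hy'
      rw [ht] at h₁ h₂
      exact Eq.trans h₁ (Eq.symm h₂)
  refine ⟨⟨Quot r, TypeCat.ofHom e⟩, ⟨ql, ?_⟩, ⟨qr, ?_⟩, (hq x y hy).symm⟩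
  · ext x
    rfl
  · ext y
    rfl

theorem sol_eq_behaviourallyEquivalent (hsing : ∀ L, (lift L).PreservesSingletons)
    (A : EqSystem.{u} V M ar)
    (a : ∀ x, Fin (ar (A.op x)) → A.carrier) (ha : ∀ x i, A.arg x i = .inl (a x i))
    (str : A.carrier ⟶ T.obj A.carrier)
    (hstr : ∀ x, str x ∈ (lift (A.op x)).app A.carrier (fun i => {a x i}))
    (D : Endofunctor.Coalgebra T) (κ : V → Set D.V) (x : A.carrier) :
    A.sol lift hmono D κ x = {y | BehaviourallyEquivalent ⟨A.carrier, str⟩ D x y} :=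
  (sol_le_behaviourallyEquivalent lift hmono hsing A a ha str hstr D κ x).antisymm
    (behaviourallyEquivalent_le_sol lift hmono A a ha str hstr D κ x)

/-! ### From finite systems to expressions -/

open Classical in
/-- The system with states `X` in which the states in `B` are cut off and replaced by variables
when they occur as arguments. -/
noncomputable def EqSystem.cut {X : Type u} (op : X → M) (a : ∀ x, Fin (ar (op x)) → X) (ζ : X → V)
    (B : Set X) : EqSystem.{u} V M ar where
  carrier := X
  op := op
  arg x i := if a x i ∈ B then .inr (ζ (a x i)) else .inl (a x i)

/-- Closing at `ζ x` undoes the cut at `x`; injectivity of `ζ` leaves the variables of the other cut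
states alone. -/
theorem EqSystem.sol_close_cut_insert {X : Type u} (op : X → M)
    (a : ∀ x, Fin (ar (op x)) → X) {ζ : X → V} (hζ : ζ.Injective) {B : Set X} {x : X}
    (hx : x ∉ B) (D : Endofunctor.Coalgebra T) (κ : V → Set D.V) :
    ((EqSystem.cut op a ζ (insert x B)).close (ζ x) x).sol lift hmono D κ x =
      (EqSystem.cut op a ζ B).sol lift hmono D κ x := by
  have h : ∀ b c : ∀ x, Fin (ar (op x)) → X ⊕ V, b = c →
      (EqSystem.mk X op b).sol lift hmono D κ x =
        (EqSystem.mk X op c).sol lift hmono D κ x := by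
    rintro b _ rfl
    rfl
  refine h _ _ ?_
  funext y i
  by_cases h : a y i = x
  · simp [cut, redirect, h, hx]
  · by_cases h' : a y i ∈ B
    · simp [cut, redirect, h, h', hζ.eq_iff]
    · simp [cut, redirect, h, h']

open Classical in
/-- Components of greatest solutions of finite systems are expressible. -/
theorem exists_expr_sem_eq_sol_cut {X : Type u} [Finite X] (op : X → M)
    (a : ∀ x, Fin (ar (op x)) → X) {ζ : X → V} (hζ : ζ.Injective) (B : Set X) (x : X) :
    ∃ φ : Expr V M ar, φ.Guarded ∧ φ.freeVars ⊆ ζ '' B ∧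
      ∀ (D : Endofunctor.Coalgebra T) (κ : V → Set D.V), φ.sem lift hmono D κ =
        Sum.elim ((EqSystem.cut op a ζ B).sol lift hmono D κ) κ
          (if x ∈ B then .inr (ζ x) else .inl x) := by
  -- The induction goes upwards: `B` collects the states already bound by an enclosing `ν`, and `X`
  -- is finite.
  induction B using WellFoundedGT.induction generalizing x with
  | ind B ih =>
    by_cases hx : x ∈ B
    · refine ⟨.var (ζ x), trivial, ?_, fun D κ => ?_⟩
      · rintro _ ⟨⟩
        exact ⟨x, hx, rfl⟩
      · rw [if_pos hx]
        rfl
    · choose φ hg hfree hsem using ih (insert x B) (Set.ssubset_insert hx)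
      refine ⟨.nu (ζ x) (.mod (op x) fun i => φ (a x i)), ⟨nofun, fun i => hg _⟩, ?_,
        fun D κ => ?_⟩
      · rintro z ⟨hz, hzx⟩
        obtain ⟨i, hi⟩ := Set.mem_iUnion.1 hz
        obtain ⟨y, rfl | hy, rfl⟩ := hfree _ hi
        · exact absurd rfl hzx
        · exact ⟨y, hy, rfl⟩
      · rw [if_neg hx]
        refine Eq.trans ?_ (EqSystem.sol_close_cut_insert lift hmono op a hζ hx D κ)
        refine EqSystem.gfp_eq_sol_close lift hmono (EqSystem.cut op a ζ (insert x B)) (ζ x) x D κ _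
          fun Y => ?_
        refine Eq.trans ?_
          (EqSystem.sol_eq lift hmono (EqSystem.cut op a ζ (insert x B)) D _ x).symm
        refine congrArg (fun P => D.str ⁻¹' (lift (op x)).app D.V P) (funext fun i => ?_)
        exact hsem (a x i) D _

/-! ### The two directions of the theorem -/

theorem exists_denotes_of_closed_guarded (hsing : ∀ L, (lift L).PreservesSingletons)
    (φ : Expr V M ar) (hc : φ.Closed) (hg : φ.Guarded) :
    ∃ (C : Endofunctor.Coalgebra T) (x : C.V), Finite C.V ∧ Denotes lift hmono φ C x := by
  obtain ⟨A, p, hfin, harg, hp, hsem⟩ := φ.exists_eqSystem lift hmono hg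
  have hno : ∀ z, z ∉ φ.freeVars := fun z hz => by
    rw [show φ.freeVars = ∅ from hc] at hz
    exact hz
  have ha : ∀ x i, ∃ y, A.arg x i = .inl y := fun x i => by
    cases h : A.arg x i with
    | inl y => exact ⟨y, rfl⟩
    | inr z => exact absurd (harg x i z h) (hno z)
  choose a ha using ha
  -- The unique element of each lifting serves as the successor of `x`.
  choose t ht using fun x => hsing (A.op x) A.carrier (a x)
  cases p with
  | inr z => exact absurd (φ.unguardedVars_subset_freeVars (hp z rfl)) (hno z)
  | inl s =>
    refine ⟨⟨A.carrier, TypeCat.ofHom t⟩, s, hfin, fun D κ => ?_⟩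
    rw [hsem]
    exact sol_eq_behaviourallyEquivalent lift hmono hsing A a ha (TypeCat.ofHom t)
      (fun x => by rw [ht]; exact rfl) D κ s

theorem exists_closed_guarded_denotes [Infinite V]
    (hsing : ∀ L, (lift L).PreservesSingletons)
    (hexpr : StronglyExpressive
      (Set.range fun L : M => (⟨ar L, lift L⟩ : Σ n : ℕ, PredicateLifting T n)))
    (C : Endofunctor.Coalgebra T) (x : C.V) [Finite C.V] :
    ∃ φ : Expr V M ar, φ.Closed ∧ φ.Guarded ∧ Denotes lift hmono φ C x := by
  have h : ∀ x : C.V, ∃ (L : M) (a : Fin (ar L) → C.V),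
      C.str x ∈ (lift L).app C.V (fun i => {a i}) := fun x => by
    obtain ⟨_, ⟨L, rfl⟩, a, ha⟩ := hexpr C.V (C.str x)
    exact ⟨L, a, ha.le rfl⟩
  choose op a ha using h
  have hV : ∃ ζ : C.V → V, ζ.Injective := by
    obtain ⟨n, ⟨e⟩⟩ := Finite.exists_equiv_fin C.V
    exact ⟨fun x => Infinite.natEmbedding V (e x),
      (Infinite.natEmbedding V).injective.comp (Fin.val_injective.comp e.injective)⟩
  obtain ⟨ζ, hζ⟩ := hV
  -- With `B = ∅` nothing is cut, so the system is variable-free and `φ` closed.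
  obtain ⟨φ, hg, hfree, hsem⟩ :=
    exists_expr_sem_eq_sol_cut (T := T) lift hmono op a hζ ∅ x
  refine ⟨φ, Set.subset_empty_iff.1 (by simpa using hfree), hg, fun D κ => ?_⟩
  rw [hsem, if_neg (Set.notMem_empty x)]
  exact sol_eq_behaviourallyEquivalent lift hmono hsing (EqSystem.cut op a ζ ∅) a
    (fun y i => if_neg (Set.notMem_empty _)) C.str ha D κ x

end

end GenExpr

theorem mainTheorem3 (T : Type u ⥤ Type u)
    (V : Type v) [Infinite V] (M : Type w) (ar : M → ℕ)
    (lift : ∀ L : M, GenExpr.PredicateLifting T (ar L))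
    (hmono : ∀ L, (lift L).IsMonotone)
    (hsing : ∀ L, (lift L).PreservesSingletons)
    (hexpr : GenExpr.StronglyExpressive
      (Set.range fun L : M => (⟨ar L, lift L⟩ : Σ n : ℕ, GenExpr.PredicateLifting T n))) :
    (∀ φ : GenExpr.Expr V M ar, φ.Closed → φ.Guarded →
      ∃ (C : Endofunctor.Coalgebra T) (x : C.V), Finite C.V ∧
        GenExpr.Denotes lift hmono φ C x) ∧
    (∀ (C : Endofunctor.Coalgebra T) (x : C.V), Finite C.V →
      ∃ φ : GenExpr.Expr V M ar, φ.Closed ∧ φ.Guarded ∧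
        GenExpr.Denotes lift hmono φ C x) :=
  ⟨GenExpr.exists_denotes_of_closed_guarded lift hmono hsing,
    fun C x _ => GenExpr.exists_closed_guarded_denotes lift hmono hsing hexpr C x⟩
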